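/- Let $n\in\mathbb N_0$ and let $\Omega\subseteq\mathbb R^n_x\times\mathbb R_y$ be open and $y$-simple, i.e., for every $x\in\mathbb R^n$ the intersection $(\{x\}\times\mathbb R)\cap\Omega$ is connected or empty. Let $\mathrm{pr}_X\Omega\subseteq\mathbb R^n$ be the (open) projection of $\Omega$ to $\mathbb R^n_x$, and for an open set $U$ let $\mathcal D'(U)$ be the space of (real) distributions on $U$. Let $T_{\mathbf 1_{\mathbb R}}\in\mathcal D'(\mathbb R)$ be the regular distribution of the constant function $1$, $\langle T_{\mathbf 1_{\mathbb R}},\psi\rangle=\int_{\mathbb R}\psi(y)\,dy$. For $v\in\mathcal D'(\mathrm{pr}_X\Omega)$ the tensor product $v\otimes T_{\mathbf 1_{\mathbb R}}\in\mathcal D'(\mathrm{pr}_X\Omega\times\mathbb R)$ is given by $\langle v\otimes T_{\mathbf 1_{\mathbb R}},\varphi\rangle=\langle v(x),\int_{\mathbb R}\varphi(x,y)\,dy\rangle$. Then for every $u\in\mathcal D'(\Omega)$, $$\partial_y u=0\quad\Longleftrightarrow\quad \exists\, v\in\mathcal D'(\mathrm{pr}_X\Omega):\ u=(v\otimes T_{\mathbf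 1_{\mathbb R}})\big|_\Omega .$$ -/

import Mathlib

open TopologicalSpace Set MeasureTheory
open scoped Distributions LineDeriv ContDiff

noncomputable section

namespace DistributionTensor

/-- The open set `X × Y` of the product space. -/
def prodOpens {E F : Type*} [TopologicalSpace E] [TopologicalSpace F] (X : Opens E)
    (Y : Opens F) : Opens (E × F) :=
  ⟨(X : Set E) ×ˢ (Y : Set F), X.isOpen.prod Y.isOpen⟩

/-- The projection `pr_X Ω` of an open set `Ω ⊆ E × F` to `E`. -/
def projFst {E F : Type*} [TopologicalSpace E] [TopologicalSpace F] (Ω : Opens (E × F)) :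
    Opens E :=
  ⟨Prod.fst '' (Ω : Set (E × F)), isOpenMap_fst _ Ω.isOpen⟩

theorem le_prodOpens_projFst {E F : Type*} [TopologicalSpace E] [TopologicalSpace F]
    (Ω : Opens (E × F)) : Ω ≤ prodOpens (projFst Ω) ⊤ :=
  fun p hp => ⟨⟨p, hp, rfl⟩, mem_univ p.2⟩

/-- A set `U ⊆ E × ℝ_y` is `y`-simple if for every `x` the intersection
`({x} × ℝ) ∩ U` is connected or empty. -/
def IsYSimple {E : Type*} [TopologicalSpace E] (U : Set (E × ℝ)) : Prop :=
  ∀ x : E, IsConnected (({x} ×ˢ univ) ∩ U) ∨ ({x} ×ˢ univ) ∩ U = ∅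

variable {E F : Type*} [NormedAddCommGroup E] [NormedSpace ℝ E]
  [NormedAddCommGroup F] [NormedSpace ℝ F]

/-- The restriction `u|_Ω` of a distribution `u ∈ 𝓓'(Ω')` to an open subset `Ω ⊆ Ω'`:
test functions on `Ω` are regarded as test functions on `Ω'`. -/
def restriction {Ω Ω' : Opens E} (_h : Ω ≤ Ω') (u : 𝓓'(Ω', ℝ)) : 𝓓'(Ω, ℝ) :=
  ContinuousLinearMap.comp (σ₁₂ := RingHom.id ℝ) (σ₂₃ := RingHom.id ℝ)
    (u : 𝓓(Ω', ℝ) →L[ℝ] ℝ) (TestFunction.monoCLM ℝ : 𝓓(Ω, ℝ) →L[ℝ] 𝓓(Ω', ℝ))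

theorem restriction_apply {Ω Ω' : Opens E} (h : Ω ≤ Ω') (u : 𝓓'(Ω', ℝ)) (φ : 𝓓(Ω, ℝ)) :
    restriction h u φ =
      u ⟨φ, φ.contDiff, φ.hasCompactSupport, φ.tsupport_subset.trans h⟩ := by
  change u (TestFunction.monoCLM ℝ φ) = _
  congr 1
  ext x
  simp [h]

/-- The regular distribution `T_f` on `Ω`, `⟨T_f, φ⟩ = ∫ φ f`, of a function `f` that is locally
integrable on `Ω`. -/
def regular [MeasureSpace E] [OpensMeasurableSpace E] (Ω : Opens E) (f : E → ℝ) : 𝓓'(Ω, ℝ) :=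
  (TestFunction.integralAgainstBilinCLM (ContinuousLinearMap.mul ℝ ℝ) volume f :
    𝓓(Ω, ℝ) →L[ℝ] ℝ)

/-- The regular distribution `T_1` on `ℝ` is integration. -/
theorem regular_indicator_univ_apply (ψ : 𝓓((⊤ : Opens ℝ), ℝ)) :
    regular (⊤ : Opens ℝ) (indicator univ (fun _ => (1 : ℝ))) ψ = ∫ y, ψ y := by
  have h : LocallyIntegrableOn (indicator univ (fun _ : ℝ => (1 : ℝ)))
      ((⊤ : Opens ℝ) : Set ℝ) volume := by
    rw [indicator_univ]
    exact (locallyIntegrable_const 1).locallyIntegrableOn _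
  change TestFunction.integralAgainstBilinCLM (ContinuousLinearMap.mul ℝ ℝ) volume _ ψ = _
  rw [TestFunction.integralAgainstBilinCLM_eq_integral h]
  simp

variable {X : Opens E} {Y : Opens F}

/-- The partial function `φ(x, ·)` of a test function `φ` on `X × Y`, as a test function on `Y`. -/
def slice (φ : 𝓓(prodOpens X Y, ℝ)) (x : E) : 𝓓(Y, ℝ) where
  toFun y := φ (x, y)
  contDiff' := φ.contDiff.comp (contDiff_const.prodMk contDiff_id)
  hasCompactSupport' := by
    refine HasCompactSupport.intro (φ.hasCompactSupport.isCompact.image continuous_snd) ?_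
    intro y hy
    by_contra h
    exact hy ⟨(x, y), subset_tsupport _ h, rfl⟩
  tsupport_subset' := by
    have hc : IsCompact (Prod.snd '' tsupport φ) :=
      φ.hasCompactSupport.isCompact.image continuous_snd
    refine Subset.trans (b := Prod.snd '' tsupport φ) (closure_minimal ?_ hc.isClosed) ?_
    · intro y hy
      exact ⟨(x, y), subset_tsupport _ hy, rfl⟩
    · rintro _ ⟨p, hp, rfl⟩
      exact (φ.tsupport_subset hp).2

@[simp]
theorem slice_apply (φ : 𝓓(prodOpens X Y, ℝ)) (x : E) (y : F) : slice φ x y = φ (x, y) := rfl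

theorem norm_iteratedFDeriv_slice_le {f : E × F → ℝ} (hf : ContDiff ℝ ∞ f) (i : ℕ) (x : E)
    (y : F) : ‖iteratedFDeriv ℝ i (fun y => f (x, y)) y‖ ≤ ‖iteratedFDeriv ℝ i f (x, y)‖ := by
  have h1 : (fun y => f (x, y)) = (fun z => f ((x, 0) + z)) ∘ ContinuousLinearMap.inr ℝ E F := by
    ext y; simp
  have h2 : ContDiff ℝ ∞ (fun z => f ((x, 0) + z)) := hf.comp (contDiff_const.add contDiff_id)
  rw [h1, ContinuousLinearMap.iteratedFDeriv_comp_right _ h2 _ (mod_cast le_top),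
    iteratedFDeriv_comp_add_left']
  refine (ContinuousMultilinearMap.norm_compContinuousLinearMap_le _ _).trans ?_
  have h3 : ∏ _j : Fin i, ‖ContinuousLinearMap.inr ℝ E F‖ ≤ 1 :=
    Finset.prod_le_one (fun _ _ => norm_nonneg _)
      (fun _ _ => ContinuousLinearMap.norm_inr_le_one ℝ E F)
  simpa using mul_le_of_le_one_right (norm_nonneg _) h3

/-- On test functions supported in a fixed compact set, a distribution is bounded by finitely many
derivatives. -/
theorem exists_bound (w : 𝓓'(Y, ℝ)) {L : Set F} (hL : IsCompact L) (hLY : L ⊆ Y) :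
    ∃ (m : ℕ) (C : ℝ), 0 ≤ C ∧ ∀ (ψ : 𝓓(Y, ℝ)) (M : ℝ), Function.support ψ ⊆ L → 0 ≤ M →
      (∀ i ≤ m, ∀ y, ‖iteratedFDeriv ℝ i ψ y‖ ≤ M) → |w ψ| ≤ C * M := by
  let K : Compacts F := ⟨L, hL⟩
  let q : 𝓓_{K}(F, ℝ) →L[ℝ] ℝ :=
    (w : 𝓓(Y, ℝ) →L[ℝ] ℝ).comp (TestFunction.ofSupportedInCLM ℝ (K := K) hLY)
  have hq : Continuous ((normSeminorm ℝ ℝ).comp q.toLinearMap) := continuous_norm.comp q.continuous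
  obtain ⟨m, C, -, h⟩ :=
    Seminorm.bound_of_continuous (ContDiffMapSupportedIn.withSeminorms ℝ F ℝ ⊤ K) _ hq
  refine ⟨m.sup id, C, C.2, fun ψ M hψ hM hb => ?_⟩
  let ψ' : 𝓓_{K}(F, ℝ) := .of_support_subset ψ.contDiff hψ
  have h1 : |w ψ| ≤ C * (m.sup fun i => ContDiffMapSupportedIn.seminorm ℝ F ℝ ⊤ K i) ψ' := h ψ'
  refine h1.trans (mul_le_mul_of_nonneg_left ?_ C.2)
  refine Seminorm.finset_sup_apply_le hM fun i hi => ?_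
  rw [ContDiffMapSupportedIn.seminorm_top_le_iff ℝ hM]
  exact fun y _ => hb i (Finset.le_sup (f := id) hi) y

theorem iteratedFDeriv_fderiv_apply {V : Type*} [NormedAddCommGroup V] [NormedSpace ℝ V]
    {f : V → ℝ} (hf : ContDiff ℝ ∞ f) (k : V) (i : ℕ) (z : V) :
    iteratedFDeriv ℝ i (fun z => fderiv ℝ f z k) z = fderiv ℝ (iteratedFDeriv ℝ i f) z k := by
  induction i generalizing z with
  | zero =>
    ext m
    have h : DifferentiableAt ℝ (iteratedFDeriv ℝ 0 f) z :=
      (hf.differentiable_iteratedFDeriv (mod_cast WithTop.coe_lt_top 0)) z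
    have h2 : fderiv ℝ (fun z => iteratedFDeriv ℝ 0 f z m) z k =
        fderiv ℝ (iteratedFDeriv ℝ 0 f) z k m := by
      rw [fderiv_continuousMultilinear_apply_const_apply h]
    rw [← h2]
    simp
  | succ i ih =>
    ext m
    have hd : ∀ j, ContDiff ℝ ∞ (iteratedFDeriv ℝ j f) := fun j =>
      hf.iteratedFDeriv_right (mod_cast le_top)
    have h1 : DifferentiableAt ℝ (iteratedFDeriv ℝ (i + 1) f) z :=
      (hd (i + 1)).differentiable (by simp) z
    have h2 : DifferentiableAt ℝ (fderiv ℝ (iteratedFDeriv ℝ i f)) z :=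
      ((hd i).fderiv_right (m := ∞) (mod_cast le_top)).differentiable (by simp) z
    have hs : IsSymmSndFDerivAt ℝ (iteratedFDeriv ℝ i f) z :=
      ((hd i).contDiffAt).isSymmSndFDerivAt (by
        rw [minSmoothness_of_isRCLikeNormedField]
        exact WithTop.coe_le_coe.2 (OrderTop.le_top (2 : ℕ∞)))
    rw [iteratedFDeriv_succ_apply_left, funext ih,
      ← fderiv_continuousMultilinear_apply_const_apply h1]
    simp_rw [iteratedFDeriv_succ_apply_left]
    rw [fderiv_clm_apply h2 (differentiableAt_const _)]
    have h3 : DifferentiableAt ℝ (fun y => fderiv ℝ (iteratedFDeriv ℝ i f) y (m 0)) z :=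
      h2.clm_apply (differentiableAt_const _)
    rw [fderiv_continuousMultilinear_apply_const_apply h3,
      fderiv_clm_apply h2 (differentiableAt_const _)]
    simp [hs.eq (m 0) k]

/-- First order Taylor expansion, uniformly in the base point. -/
theorem eventually_taylor {V G : Type*} [NormedAddCommGroup V] [NormedSpace ℝ V]
    [NormedAddCommGroup G] [NormedSpace ℝ G] {f : V → G} (hf : ContDiff ℝ 1 f)
    (hs : HasCompactSupport f) {ε : ℝ} (hε : 0 < ε) :
    ∀ᶠ k in nhds (0 : V), ∀ z, ‖f (k + z) - f z - fderiv ℝ f z k‖ ≤ ε * ‖k‖ := by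
  have hc : UniformContinuous (fderiv ℝ f) :=
    (hs.fderiv ℝ).uniformContinuous_of_continuous (hf.continuous_fderiv (by simp))
  obtain ⟨δ, hδ, h⟩ := Metric.uniformContinuous_iff.1 hc ε hε
  filter_upwards [Metric.ball_mem_nhds (0 : V) hδ] with k hk z
  have hk' : ‖k‖ < δ := by simpa using hk
  have := Convex.norm_image_sub_le_of_norm_fderiv_le' (𝕜 := ℝ) (f := f) (s := Metric.ball z δ)
    (φ := fderiv ℝ f z) (C := ε) (x := z) (y := k + z)
    (fun x _ => hf.differentiable (by simp) x)
    (fun x hx => by rw [← dist_eq_norm]; exact (h hx).le)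
    (convex_ball z δ) (Metric.mem_ball_self hδ) (by simpa [dist_eq_norm] using hk')
  simpa using this

theorem lineDeriv_coe {V : Type*} [NormedAddCommGroup V] [NormedSpace ℝ V] {U : Opens V}
    (φ : 𝓓(U, ℝ)) (v : V) : ((∂_{v} φ : 𝓓(U, ℝ)) : V → ℝ) = fun z => fderiv ℝ φ z v := by
  ext z
  rw [TestFunction.lineDerivOp_eq_lineDerivCLM ℝ, TestFunction.lineDerivCLM_eq_fderivCLM,
    TestFunction.fderivCLM_apply]
  simp

/-- The function `x ↦ ⟨w, φ(x, ·)⟩`. -/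
def pairing (w : 𝓓'(Y, ℝ)) (φ : 𝓓(prodOpens X Y, ℝ)) (x : E) : ℝ := w (slice φ x)

theorem abs_pairing_le (w : 𝓓'(Y, ℝ)) {L : Set F} {m : ℕ} {C : ℝ}
    (hC : ∀ (ψ : 𝓓(Y, ℝ)) (M : ℝ), Function.support ψ ⊆ L → 0 ≤ M →
      (∀ i ≤ m, ∀ y, ‖iteratedFDeriv ℝ i ψ y‖ ≤ M) → |w ψ| ≤ C * M)
    (φ : 𝓓(prodOpens X Y, ℝ)) (hφ : Function.support φ ⊆ Prod.snd ⁻¹' L) {M : ℝ} (hM : 0 ≤ M)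
    (hb : ∀ i ≤ m, ∀ z, ‖iteratedFDeriv ℝ i φ z‖ ≤ M) (x : E) : |pairing w φ x| ≤ C * M :=
  hC _ M (fun y hy => hφ (show (x, y) ∈ Function.support φ from hy)) hM fun i hi y =>
    (norm_iteratedFDeriv_slice_le φ.contDiff i x y).trans (hb i hi _)

theorem support_lineDeriv_subset {U : Opens (E × F)} (φ : 𝓓(U, ℝ)) (v : E × F) {L : Set (E × F)}
    (hL : IsClosed L) (h : Function.support φ ⊆ L) :
    Function.support (∂_{v} φ : 𝓓(U, ℝ)) ⊆ L := by
  rw [lineDeriv_coe]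
  refine Subset.trans (fun z hz => ?_) ((support_fderiv_subset ℝ (f := φ)).trans
    (closure_minimal h hL))
  intro h0
  exact hz (by simp [h0])

theorem pairing_eq_zero (w : 𝓓'(Y, ℝ)) (φ : 𝓓(prodOpens X Y, ℝ)) {x : E}
    (h : ∀ y, φ (x, y) = 0) : pairing w φ x = 0 := by
  have : slice φ x = 0 := by ext y; simpa using h y
  rw [pairing, this, map_zero]

variable [FiniteDimensional ℝ E]

theorem hasFDerivAt_pairing (w : 𝓓'(Y, ℝ)) (φ : 𝓓(prodOpens X Y, ℝ)) (x : E) :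
    ∃ A : E →L[ℝ] ℝ, HasFDerivAt (pairing w φ) A x ∧
      ∀ e, A e = pairing w (∂_{((e, 0) : E × F)} φ) x := by
  let A : E →ₗ[ℝ] ℝ :=
    { toFun := fun e => pairing w (∂_{((e, 0) : E × F)} φ) x
      map_add' := fun e e' => by
        unfold pairing
        rw [← map_add]
        congr 1
        ext y
        have : ((e + e', 0) : E × F) = (e, 0) + (e', 0) := by simp
        simp [lineDeriv_coe, this, -Prod.mk_add_mk]
      map_smul' := fun c e => by
        unfold pairing
        rw [← map_smul]
        congr 1
        ext y
        have : ((c • e, 0) : E × F) = c • (e, 0) := by simp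
        simp [lineDeriv_coe, this, -Prod.smul_mk] }
  refine ⟨LinearMap.toContinuousLinearMap A, ?_, fun e => rfl⟩
  have hK : IsCompact (tsupport φ) := φ.hasCompactSupport
  obtain ⟨m, C, hC0, hC⟩ := exists_bound w (hK.image continuous_snd)
    (by rintro _ ⟨p, hp, rfl⟩; exact (φ.tsupport_subset hp).2)
  have hd : ∀ j, ContDiff ℝ ∞ (iteratedFDeriv ℝ j φ) := fun j =>
    φ.contDiff.iteratedFDeriv_right (mod_cast le_top)
  rw [hasFDerivAt_iff_isLittleO_nhds_zero, Asymptotics.isLittleO_iff]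
  intro c hc
  have hε : 0 < c / (C + 1) := by positivity
  have hev : ∀ᶠ h in nhds (0 : E), ∀ i ∈ Finset.range (m + 1), ∀ z : E × F,
      ‖iteratedFDeriv ℝ i φ ((h, 0) + z) - iteratedFDeriv ℝ i φ z -
        fderiv ℝ (iteratedFDeriv ℝ i φ) z (h, 0)‖ ≤ c / (C + 1) * ‖h‖ := by
    rw [Filter.eventually_all_finset]
    intro i _
    have h1 := eventually_taylor ((hd i).of_le (mod_cast le_top))
      (φ.hasCompactSupport.iteratedFDeriv i) hε
    have h2 : Filter.Tendsto (fun h : E => ((h, 0) : E × F)) (nhds 0) (nhds 0) := by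
      have : Continuous (fun h : E => ((h, 0) : E × F)) := by fun_prop
      simpa only [Prod.mk_zero_zero] using this.tendsto 0
    filter_upwards [h2.eventually h1] with h hh z
    simpa [Prod.norm_def] using hh z
  filter_upwards [hev] with h hh
  set v : E × F := (h, 0)
  let R : 𝓓(Y, ℝ) := slice φ (x + h) - slice φ x - slice (∂_{v} φ) x
  have hR : pairing w φ (x + h) - pairing w φ x - (LinearMap.toContinuousLinearMap A) h = w R := by
    simp only [R, map_sub]
    rfl
  have hsuppφ : Function.support φ ⊆ Prod.snd ⁻¹' (Prod.snd '' tsupport φ) := fun z hz =>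
    ⟨z, subset_tsupport _ hz, rfl⟩
  have hsuppR : Function.support R ⊆ Prod.snd '' tsupport φ := by
    intro y hy
    by_contra hn
    have h0 : ∀ x', φ (x', y) = 0 := fun x' => by
      by_contra h'
      exact hn (hsuppφ (show (x', y) ∈ Function.support φ from h'))
    have h1 : (∂_{v} φ : 𝓓(prodOpens X Y, ℝ)) (x, y) = 0 := by
      by_contra h'
      have := support_lineDeriv_subset φ v
        ((hK.image continuous_snd).isClosed.preimage continuous_snd) hsuppφ h'
      exact hn this
    exact hy (by simp [R, h0, h1])
  have hRΨ : (R : F → ℝ) = fun y => (fun z => φ (v + z) - φ z - fderiv ℝ φ z v) (x, y) := by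
    ext y
    simp [R, lineDeriv_coe, v, add_comm]
  have hs1 : ContDiff ℝ ∞ (fun z => φ (v + z)) := φ.contDiff.comp (contDiff_const.add contDiff_id)
  have hs2 : ContDiff ℝ ∞ (fun z => fderiv ℝ φ z v) :=
    (φ.contDiff.fderiv_right (m := ∞) (mod_cast le_top)).clm_apply contDiff_const
  have hbound : |w R| ≤ C * (c / (C + 1) * ‖h‖) := by
    refine hC R _ hsuppR (by positivity) fun i hi y => ?_
    rw [hRΨ]
    refine (norm_iteratedFDeriv_slice_le ((hs1.sub φ.contDiff).sub hs2) i x y).trans ?_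
    have e1 : iteratedFDeriv ℝ i (fun z => φ (v + z) - φ z - fderiv ℝ φ z v) (x, y) =
        iteratedFDeriv ℝ i φ (v + (x, y)) - iteratedFDeriv ℝ i φ (x, y) -
        fderiv ℝ (iteratedFDeriv ℝ i φ) (x, y) v := by
      have hi' : (i : WithTop ℕ∞) ≤ ∞ := mod_cast le_top
      have a1 := iteratedFDeriv_sub_apply (x := (x, y)) (i := i)
        ((hs1.sub φ.contDiff).of_le hi').contDiffAt (hs2.of_le hi').contDiffAt
      have a2 := iteratedFDeriv_sub_apply (x := (x, y)) (i := i)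
        (hs1.of_le hi').contDiffAt (φ.contDiff.of_le hi').contDiffAt
      rw [iteratedFDeriv_comp_add_left'] at a2
      rw [← iteratedFDeriv_fderiv_apply φ.contDiff, ← a2]
      exact a1
    rw [e1]
    exact hh i (Finset.mem_range.2 (by omega)) _
  rw [hR, Real.norm_eq_abs]
  refine hbound.trans ?_
  rw [← mul_assoc]
  refine mul_le_mul_of_nonneg_right ?_ (norm_nonneg _)
  rw [mul_div_assoc', div_le_iff₀ (by positivity)]
  nlinarith

theorem fderiv_pairing (w : 𝓓'(Y, ℝ)) (φ : 𝓓(prodOpens X Y, ℝ)) (x e : E) :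
    fderiv ℝ (pairing w φ) x e = pairing w (∂_{((e, 0) : E × F)} φ) x := by
  obtain ⟨A, hA, h⟩ := hasFDerivAt_pairing w φ x
  rw [hA.fderiv, h]

theorem contDiff_pairing (w : 𝓓'(Y, ℝ)) (φ : 𝓓(prodOpens X Y, ℝ)) :
    ContDiff ℝ ∞ (pairing w φ) := by
  rw [contDiff_infty]
  intro n
  induction n generalizing φ with
  | zero =>
    refine contDiff_zero.2 (continuous_iff_continuousAt.2 fun x => ?_)
    exact (hasFDerivAt_pairing w φ x).choose_spec.1.continuousAt
  | succ n ih =>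
    have := (contDiff_succ_iff_fderiv_apply (𝕜 := ℝ) (n := n) (f := pairing w φ)).2
      ⟨fun x => (hasFDerivAt_pairing w φ x).choose_spec.1.differentiableAt, by simp, fun e => by
        simpa only [fderiv_pairing] using ih _⟩
    simpa using this

theorem norm_iteratedFDeriv_pairing_le (w : 𝓓'(Y, ℝ)) {L : Set F} (hL : IsClosed L) {m : ℕ}
    {C : ℝ} (hC0 : 0 ≤ C)
    (hC : ∀ (ψ : 𝓓(Y, ℝ)) (M : ℝ), Function.support ψ ⊆ L → 0 ≤ M →
      (∀ i ≤ m, ∀ y, ‖iteratedFDeriv ℝ i ψ y‖ ≤ M) → |w ψ| ≤ C * M) (k : ℕ)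
    (φ : 𝓓(prodOpens X Y, ℝ)) (hφ : Function.support φ ⊆ Prod.snd ⁻¹' L) {M : ℝ} (hM : 0 ≤ M)
    (hb : ∀ i ≤ m + k, ∀ z, ‖iteratedFDeriv ℝ i φ z‖ ≤ M) (x : E) :
    ‖iteratedFDeriv ℝ k (pairing w φ) x‖ ≤ C * M := by
  induction k generalizing φ M with
  | zero => simpa using abs_pairing_le w hC φ hφ hM hb x
  | succ k ih =>
    refine ContinuousMultilinearMap.opNorm_le_bound (by positivity) fun u => ?_
    have hs : ContDiff ℝ ∞ (fderiv ℝ (pairing w φ)) :=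
      (contDiff_pairing w φ).fderiv_right (m := ∞) (mod_cast le_top)
    rw [iteratedFDeriv_succ_apply_right,
      ← iteratedFDeriv_clm_apply_const_apply hs (mod_cast le_top)]
    simp only [fderiv_pairing]
    set e := u (Fin.last k)
    have h1 := ih (∂_{((e, 0) : E × F)} φ)
      (support_lineDeriv_subset φ _ (hL.preimage continuous_snd) hφ) (M := ‖e‖ * M) (by positivity)
      (fun i hi z => by
        rw [lineDeriv_coe]
        refine (norm_iteratedFDeriv_clm_apply_const (N := ∞)
          (φ.contDiff.fderiv_right (m := ∞) (mod_cast le_top)).contDiffAt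
          (mod_cast le_top)).trans ?_
        rw [norm_iteratedFDeriv_fderiv]
        have : ‖((e, 0) : E × F)‖ = ‖e‖ := by simp [Prod.norm_def]
        rw [this]
        exact mul_le_mul_of_nonneg_left (hb _ (by omega) z) (norm_nonneg _))
    refine (ContinuousMultilinearMap.le_opNorm _ _).trans ?_
    rw [Fin.prod_univ_castSucc]
    calc _ ≤ (C * (‖e‖ * M)) * ∏ i, ‖Fin.init u i‖ := by gcongr
      _ = _ := by simp only [Fin.init, e]; ring

/-- Partial evaluation of a distribution `w` on `Y`: the test function `x ↦ ⟨w, φ(x, ·)⟩`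
on `X`. -/
def pairingTest (w : 𝓓'(Y, ℝ)) (φ : 𝓓(prodOpens X Y, ℝ)) : 𝓓(X, ℝ) where
  toFun := pairing w φ
  contDiff' := contDiff_pairing w φ
  hasCompactSupport' := by
    refine HasCompactSupport.intro (φ.hasCompactSupport.isCompact.image continuous_fst) ?_
    intro x hx
    refine pairing_eq_zero w φ fun y => ?_
    by_contra h
    exact hx ⟨(x, y), subset_tsupport _ h, rfl⟩
  tsupport_subset' := by
    have hc : IsCompact (Prod.fst '' tsupport φ) :=
      φ.hasCompactSupport.isCompact.image continuous_fst
    refine Subset.trans (b := Prod.fst '' tsupport φ) (closure_minimal ?_ hc.isClosed) ?_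
    · intro x hx
      by_contra hn
      refine hx (pairing_eq_zero w φ fun y => ?_)
      by_contra h
      exact hn ⟨(x, y), subset_tsupport _ h, rfl⟩
    · rintro _ ⟨p, hp, rfl⟩
      exact (φ.tsupport_subset hp).1

/-- Partial evaluation `φ ↦ (x ↦ ⟨w, φ(x, ·)⟩)` as a continuous linear map. -/
def pairingCLM (X : Opens E) (w : 𝓓'(Y, ℝ)) : 𝓓(prodOpens X Y, ℝ) →L[ℝ] 𝓓(X, ℝ) :=
  have hadd : ∀ (φ ψ : 𝓓(prodOpens X Y, ℝ)) (x : E),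
      pairing w (φ + ψ) x = pairing w φ x + pairing w ψ x := fun φ ψ x => by
    unfold pairing
    rw [← map_add]
    congr 1
  have hsmul : ∀ (c : ℝ) (φ : 𝓓(prodOpens X Y, ℝ)) (x : E),
      pairing w (c • φ) x = c • pairing w φ x := fun c φ x => by
    unfold pairing
    rw [← map_smul]
    congr 1
  TestFunction.mkCLM ℝ (pairingTest w)
    (fun φ ψ => TestFunction.ext (hadd φ ψ))
    (fun c φ => TestFunction.ext (hsmul c φ))
    (by
      intro K hK
      let K₁ : Compacts E := K.map Prod.fst continuous_fst
      have hK₁ : (K₁ : Set E) ⊆ X := by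
        rintro _ ⟨p, hp, rfl⟩
        exact (hK hp).1
      have hL : IsCompact (Prod.snd '' (K : Set (E × F))) := K.isCompact.image continuous_snd
      obtain ⟨m, C, hC0, hC⟩ := exists_bound w hL (by rintro _ ⟨p, hp, rfl⟩; exact (hK hp).2)
      let T : 𝓓_{K}(E × F, ℝ) → E → ℝ := fun f => pairing w (TestFunction.ofSupportedIn hK f)
      have hT0 : ∀ f, EqOn (T f) 0 (K₁ : Set E)ᶜ := fun f x hx =>
        pairing_eq_zero w _ fun y => f.zero_on_compl fun h => hx ⟨(x, y), h, rfl⟩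
      let f₀ : 𝓓_{K}(E × F, ℝ) → 𝓓_{K₁}(E, ℝ) := fun f =>
        ⟨T f, contDiff_pairing w _, hT0 f⟩
      have hcont : Continuous f₀ := by
        let Φ : 𝓓_{K}(E × F, ℝ) →ₗ[ℝ] 𝓓_{K₁}(E, ℝ) :=
          { toFun := f₀
            map_add' := fun f g => ContDiffMapSupportedIn.ext fun x =>
              hadd (TestFunction.ofSupportedIn hK f) (TestFunction.ofSupportedIn hK g) x
            map_smul' := fun c f => ContDiffMapSupportedIn.ext fun x =>
              hsmul c (TestFunction.ofSupportedIn hK f) x }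
        refine WithSeminorms.continuous_of_isBounded
          (ContDiffMapSupportedIn.withSeminorms ℝ (E × F) ℝ ⊤ K)
          (ContDiffMapSupportedIn.withSeminorms ℝ E ℝ ⊤ K₁) Φ (.of_real fun k => ?_)
        refine ⟨Finset.range (m + k + 1), C, fun f => ?_⟩
        set q := (Finset.range (m + k + 1)).sup
          (ContDiffMapSupportedIn.seminorm ℝ (E × F) ℝ ⊤ K)
        refine (ContDiffMapSupportedIn.seminorm_top_le_iff ℝ
          (mul_nonneg hC0 (apply_nonneg q f)) k (f₀ f)).2 fun x _ => ?_
        refine norm_iteratedFDeriv_pairing_le w hL.isClosed hC0 hC k _ ?_ (apply_nonneg q f) ?_ x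
        · exact fun z hz => ⟨z, f.support_subset hz, rfl⟩
        · intro i hi z
          refine (ContDiffMapSupportedIn.norm_iteratedFDeriv_apply_le_seminorm_top ℝ
            (f := f) (x := z)).trans ?_
          exact Seminorm.le_def.1 (Finset.le_sup
            (f := ContDiffMapSupportedIn.seminorm ℝ (E × F) ℝ ⊤ K)
            (Finset.mem_range.2 (by omega : i < m + k + 1))) f
      exact (TestFunction.continuous_ofSupportedIn hK₁).comp hcont)

/-- The tensor product `v ⊗ w` of two distributions,
`⟨v ⊗ w, φ⟩ = ⟨v(x), ⟨w(y), φ(x, y)⟩⟩`. -/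
def tensor (v : 𝓓'(X, ℝ)) (w : 𝓓'(Y, ℝ)) : 𝓓'(prodOpens X Y, ℝ) :=
  ContinuousLinearMap.comp (σ₁₂ := RingHom.id ℝ) (σ₂₃ := RingHom.id ℝ)
    (v : 𝓓(X, ℝ) →L[ℝ] ℝ) (pairingCLM X w)

theorem pairingTest_apply (w : 𝓓'(Y, ℝ)) (φ : 𝓓(prodOpens X Y, ℝ)) (x : E) :
    pairingTest w φ x = w (slice φ x) := rfl

theorem tensor_apply (v : 𝓓'(X, ℝ)) (w : 𝓓'(Y, ℝ)) (φ : 𝓓(prodOpens X Y, ℝ)) :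
    tensor v w φ = v (pairingTest w φ) := rfl

/-- On products of test functions, `⟨v ⊗ w, φ ⊗ ψ⟩ = ⟨v, φ⟩ ⟨w, ψ⟩`. -/
theorem tensor_apply_of_eq_mul (v : 𝓓'(X, ℝ)) (w : 𝓓'(Y, ℝ)) (φ : 𝓓(X, ℝ)) (ψ : 𝓓(Y, ℝ))
    (χ : 𝓓(prodOpens X Y, ℝ)) (h : ∀ x y, χ (x, y) = φ x * ψ y) :
    tensor v w χ = v φ * w ψ := by
  have h1 : pairingTest w χ = w ψ • φ := by
    ext x
    have h2 : slice χ x = φ x • ψ := by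
      ext y
      simp [h]
    rw [pairingTest_apply, h2, map_smul]
    simp [mul_comm]
  rw [tensor_apply, h1, map_smul]
  simp [mul_comm]

end DistributionTensor

end

open scoped Convolution

noncomputable section

namespace DistributionTensor

/-! Write `I` for `fiberIntegral Ω`, which integrates test functions along the fibres. Its transpose
is `v ↦ (v ⊗ T_1)|_Ω`, and `∂_y u = 0` means that `u` kills every `∂_y Φ`. The claim is therefore
that `u` vanishes on the range of `∂_y` iff it factors continuously through `I`. This follows from
exactness of `𝓓(Ω) → 𝓓(Ω) → 𝓓(pr_X Ω) → 0`, with maps `∂_y` and `I`, together with continuous right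
inverses of `I` over compact sets.

`I ∘ ∂_y = 0` is the fundamental theorem of calculus (`fiberIntegral_lineDeriv`). Conversely, if `I
φ = 0`, the primitive of `φ` from `-∞` along each fibre is supported in the vertical hull of
`tsupport φ`, which is compact and, by `y`-simplicity, lies in `Ω`
(`IsYSimple.exists_lineDeriv_eq`).

For the right inverses, choose for each compact `K ⊆ pr_X Ω` a test function `θ` on `Ω` with `I θ =
1` on `K`; then `f ↦ f(x) θ(x, y)` is a continuous section of `I` on functions supported in `K`.
Hence `v(f) = u(f θ)` is well defined and continuous (`exists_eq_comp_fiberIntegral`). -/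

/-! ### Compact sets, projections and vertical hulls -/

/-- A compact subset of the image of an open set under an open map is covered by the image of a
compact set. -/
theorem exists_isCompact_image_superset {V W : Type*} [TopologicalSpace V] [LocallyCompactSpace V]
    [TopologicalSpace W] {f : V → W} (hf : IsOpenMap f) {U : Set V} (hU : IsOpen U) {K : Set W}
    (hK : IsCompact K) (hKU : K ⊆ f '' U) : ∃ L, IsCompact L ∧ L ⊆ U ∧ K ⊆ f '' L := by
  refine hK.induction_on (p := fun S => ∃ L, IsCompact L ∧ L ⊆ U ∧ S ⊆ f '' L)
    ⟨∅, isCompact_empty, empty_subset _, empty_subset _⟩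
    (fun S T hST ⟨L, h1, h2, h3⟩ => ⟨L, h1, h2, hST.trans h3⟩)
    (fun S T ⟨L, h1, h2, h3⟩ ⟨M, h4, h5, h6⟩ => ⟨L ∪ M, h1.union h4, union_subset h2 h5, by
      rw [image_union]; exact union_subset_union h3 h6⟩) fun x hx => ?_
  obtain ⟨z, hz, rfl⟩ := hKU hx
  obtain ⟨L, hL, hzL, hLU⟩ := exists_compact_subset hU hz
  exact ⟨f '' L, mem_nhdsWithin_of_mem_nhds (hf.image_mem_nhds (mem_interior_iff_mem_nhds.1 hzL)),
    L, hL, hLU, subset_rfl⟩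

/-- The union of the vertical segments with end points in `K`. -/
def verticalHull {E : Type*} (K : Set (E × ℝ)) : Set (E × ℝ) :=
  {z | ∃ a b : ℝ, (z.1, a) ∈ K ∧ (z.1, b) ∈ K ∧ a ≤ z.2 ∧ z.2 ≤ b}

/-- The hull is the continuous image of (pairs of points of `K` over the same base point) × `[0, 1]`
under convex combination. The pairs form a closed subset of `K × K` because `E` is Hausdorff. -/
theorem isCompact_verticalHull {E : Type*} [TopologicalSpace E] [T2Space E]
    {K : Set (E × ℝ)} (hK : IsCompact K) : IsCompact (verticalHull K) := by
  have hc : IsCompact (((K ×ˢ K) ∩ {p | p.1.1 = p.2.1}) ×ˢ Icc (0 : ℝ) 1) :=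
    ((hK.prod hK).inter_right (isClosed_eq (by fun_prop) (by fun_prop))).prod isCompact_Icc
  have hf : Continuous fun p : ((E × ℝ) × (E × ℝ)) × ℝ =>
      (p.1.1.1, (1 - p.2) * p.1.1.2 + p.2 * p.1.2.2) := by fun_prop
  convert hc.image hf using 1
  ext ⟨x, y⟩
  constructor
  · rintro ⟨a, b, ha, hb, hay, hyb⟩
    have hy : y ∈ segment ℝ a b := by
      rw [segment_eq_Icc (hay.trans hyb)]
      exact ⟨hay, hyb⟩
    rw [segment_eq_image] at hy
    obtain ⟨s, hs, rfl⟩ := hy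
    exact ⟨(((x, a), (x, b)), s), ⟨⟨⟨ha, hb⟩, rfl⟩, hs⟩, by simp⟩
  · rintro ⟨⟨⟨⟨x₁, a⟩, ⟨x₂, b⟩⟩, s⟩, ⟨⟨⟨ha, hb⟩, hx⟩, hs⟩, h⟩
    simp only [Prod.mk.injEq, mem_ofPred_eq] at ha hb hx h
    obtain ⟨rfl, rfl⟩ := h
    subst hx
    obtain ⟨hs0, hs1⟩ := hs
    dsimp only at hs0 hs1
    -- The pair in `K × K` is unordered, so the end points may have to be swapped.
    rcases le_total a b with hab | hab
    · exact ⟨a, b, ha, hb, by dsimp only; nlinarith, by dsimp only; nlinarith⟩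
    · exact ⟨b, a, hb, ha, by dsimp only; nlinarith, by dsimp only; nlinarith⟩

/-- Each nonempty fibre of `U` projects to a connected, hence order-connected, subset of `ℝ`. -/
theorem IsYSimple.verticalHull_subset {E : Type*} [TopologicalSpace E] {U K : Set (E × ℝ)}
    (hU : IsYSimple U) (hK : K ⊆ U) : verticalHull K ⊆ U := by
  rintro ⟨x, y⟩ ⟨a, b, ha, hb, hay, hyb⟩
  rcases hU x with h | h
  · have h1 := (h.isPreconnected.image Prod.snd continuous_snd.continuousOn).ordConnected.out
      ⟨(x, a), ⟨⟨rfl, trivial⟩, hK ha⟩, rfl⟩ ⟨(x, b), ⟨⟨rfl, trivial⟩, hK hb⟩, rfl⟩ ⟨hay, hyb⟩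
    obtain ⟨⟨x', y'⟩, ⟨⟨hx, -⟩, hz⟩, hy⟩ := h1
    obtain rfl : x' = x := hx
    obtain rfl : y' = y := hy
    exact hz
  · exact absurd (show (x, a) ∈ ({x} ×ˢ univ) ∩ U from ⟨⟨rfl, trivial⟩, hK ha⟩) (by simp [h])

/-! ### Cutoffs, multiplication by a test function, and slices -/

variable {E F : Type*} [NormedAddCommGroup E] [NormedSpace ℝ E]
  [NormedAddCommGroup F] [NormedSpace ℝ F]

/-- A test function with values in `[0, 1]` that is `1` on a given compact set. -/
theorem exists_testFunction_eq_one [FiniteDimensional ℝ E] (U : Opens E) {K : Set E}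
    (hK : IsCompact K) (hKU : K ⊆ U) :
    ∃ χ : 𝓓(U, ℝ), (∀ x, χ x ∈ Icc (0 : ℝ) 1) ∧ ∀ x ∈ K, χ x = 1 := by
  obtain ⟨L, hL, hKL, hLU⟩ := exists_compact_between hK U.isOpen hKU
  obtain ⟨f, h1, h0, hf⟩ := exists_contMDiffMap_one_nhds_of_subset_interior
    (n := ⊤) (modelWithCornersSelf ℝ E) hK.isClosed hKL
  have hs : tsupport f ⊆ L := closure_minimal
    (fun x hx => by_contra fun h => hx (h0 x h)) hL.isClosed
  exact ⟨⟨f, f.contMDiff.contDiff, hL.of_isClosed_subset (isClosed_tsupport _) hs,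
    hs.trans hLU⟩, hf, fun x hx => h1.self_of_nhdsSet x hx⟩

/-- Multiplication `f ↦ ((x, y) ↦ f x * θ (x, y))` by a fixed test function `θ`. -/
def mulFst {U : Opens (E × F)} (θ : 𝓓(U, ℝ)) (K : Compacts E) : 𝓓_{K}(E, ℝ) →L[ℝ] 𝓓(U, ℝ) :=
  let L : Compacts (E × F) := ⟨tsupport θ, θ.hasCompactSupport⟩
  let Φ : 𝓓_{K}(E, ℝ) →ₗ[ℝ] 𝓓_{L}(E × F, ℝ) :=
    { toFun f := .of_support_subset (f := fun z => f z.1 * θ z)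
        ((f.contDiff.comp contDiff_fst).mul θ.contDiff)
        (fun _ hz => subset_tsupport _ (right_ne_zero_of_mul hz))
      map_add' f g := ContDiffMapSupportedIn.ext fun z => add_mul (f z.1) (g z.1) (θ z)
      map_smul' c f := ContDiffMapSupportedIn.ext fun z => mul_assoc c (f z.1) (θ z) }
  have hΦ : Continuous Φ := by
    let θL : 𝓓_{L}(E × F, ℝ) := .of_support_subset θ.contDiff (subset_tsupport θ)
    refine WithSeminorms.continuous_of_isBounded (ContDiffMapSupportedIn.withSeminorms ℝ E ℝ ⊤ K)
      (ContDiffMapSupportedIn.withSeminorms ℝ (E × F) ℝ ⊤ L) Φ (.of_real fun k => ?_)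
    set s := ContDiffMapSupportedIn.seminorm ℝ (E × F) ℝ ⊤ L
    refine ⟨Finset.range (k + 1),
      -- The constant is read off from the Leibniz rule, with the derivatives of `f` bounded by the
      -- supremum seminorm of order up to `k`.
      ∑ i ∈ Finset.range (k + 1), (k.choose i : ℝ) * s (k - i) θL, fun f => ?_⟩
    set q := (Finset.range (k + 1)).sup (ContDiffMapSupportedIn.seminorm ℝ E ℝ ⊤ K)
    have hC : 0 ≤ ∑ i ∈ Finset.range (k + 1), (k.choose i : ℝ) * s (k - i) θL := by positivity
    refine (ContDiffMapSupportedIn.seminorm_top_le_iff ℝ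
      (mul_nonneg hC (apply_nonneg q f)) k (Φ f)).2 fun z _ => ?_
    refine (norm_iteratedFDeriv_mul_le (N := ∞) (f.contDiff.comp contDiff_fst) θ.contDiff z
      (mod_cast le_top)).trans ?_
    rw [Finset.sum_mul]
    refine Finset.sum_le_sum fun i hi => ?_
    have h1 : ‖iteratedFDeriv ℝ i (f ∘ Prod.fst) z‖ ≤ q f := by
      have h2 : (f : E → ℝ) ∘ (Prod.fst : E × F → E) = f ∘ ContinuousLinearMap.fst ℝ E F := rfl
      rw [h2, ContinuousLinearMap.iteratedFDeriv_comp_right _ f.contDiff _ (mod_cast le_top)]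
      refine (ContinuousMultilinearMap.norm_compContinuousLinearMap_le _ _).trans ?_
      have h3 : ∏ _j : Fin i, ‖ContinuousLinearMap.fst ℝ E F‖ ≤ 1 :=
        Finset.prod_le_one (fun _ _ => norm_nonneg _)
          (fun _ _ => ContinuousLinearMap.norm_fst_le ℝ E F)
      refine (mul_le_of_le_one_right (norm_nonneg _) h3).trans ?_
      refine (ContDiffMapSupportedIn.norm_iteratedFDeriv_apply_le_seminorm_top ℝ).trans ?_
      exact Seminorm.le_def.1
        (Finset.le_sup (f := ContDiffMapSupportedIn.seminorm ℝ E ℝ ⊤ K) hi) f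
    have h4 : ‖iteratedFDeriv ℝ (k - i) θ z‖ ≤ s (k - i) θL :=
      ContDiffMapSupportedIn.norm_iteratedFDeriv_apply_le_seminorm_top ℝ (f := θL)
    calc _ ≤ (k.choose i : ℝ) * q f * s (k - i) θL := by gcongr
      _ = _ := by ring
  (TestFunction.ofSupportedInCLM ℝ θ.tsupport_subset).comp ⟨Φ, hΦ⟩

theorem mulFst_apply {U : Opens (E × F)} (θ : 𝓓(U, ℝ)) (K : Compacts E) (f : 𝓓_{K}(E, ℝ))
    (z : E × F) : mulFst θ K f z = f z.1 * θ z := rfl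

theorem contDiff_slice {U : Opens (E × F)} (φ : 𝓓(U, ℝ)) (x : E) :
    ContDiff ℝ ∞ fun y => φ (x, y) :=
  φ.contDiff.comp (contDiff_const.prodMk contDiff_id)

theorem hasCompactSupport_slice {U : Opens (E × F)} (φ : 𝓓(U, ℝ)) (x : E) :
    HasCompactSupport fun y => φ (x, y) := by
  refine HasCompactSupport.intro (φ.hasCompactSupport.isCompact.image continuous_snd) ?_
  intro y hy
  by_contra h
  exact hy ⟨(x, y), subset_tsupport _ h, rfl⟩

theorem integrable_slice {U : Opens (E × ℝ)} (φ : 𝓓(U, ℝ)) (x : E) :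
    Integrable fun y => φ (x, y) :=
  (contDiff_slice φ x).continuous.integrable_of_hasCompactSupport (hasCompactSupport_slice φ x)

theorem deriv_slice {U : Opens (E × ℝ)} (φ : 𝓓(U, ℝ)) (x : E) (y : ℝ) :
    deriv (fun y => φ (x, y)) y = (∂_{((0, 1) : E × ℝ)} φ : 𝓓(U, ℝ)) (x, y) := by
  rw [lineDeriv_coe]
  have h : HasDerivAt (fun y : ℝ => (x, y)) ((0, 1) : E × ℝ) y :=
    (hasDerivAt_const y x).prodMk (hasDerivAt_id y)
  exact ((φ.contDiff.differentiable (by simp) (x, y)).hasFDerivAt.comp_hasDerivAt y h).deriv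

/-! ### Integration along the fibres -/

section FiberIntegral

variable [FiniteDimensional ℝ E]

/-- Integration along the fibres, `φ ↦ (x ↦ ∫ φ(x, y) dy)`, for test functions on `Ω`. -/
def fiberIntegral (Ω : Opens (E × ℝ)) : 𝓓(Ω, ℝ) →L[ℝ] 𝓓(projFst Ω, ℝ) :=
  (pairingCLM (projFst Ω) (regular (⊤ : Opens ℝ) (indicator univ (fun _ => (1 : ℝ))))).comp
    (TestFunction.monoCLM ℝ)

theorem fiberIntegral_apply {Ω : Opens (E × ℝ)} (φ : 𝓓(Ω, ℝ)) (x : E) :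
    fiberIntegral Ω φ x = ∫ y, φ (x, y) := by
  change regular (⊤ : Opens ℝ) (indicator univ (fun _ => (1 : ℝ)))
    (slice (TestFunction.monoCLM ℝ φ : 𝓓(prodOpens (projFst Ω) ⊤, ℝ)) x) = _
  rw [regular_indicator_univ_apply]
  simp [le_prodOpens_projFst Ω]

/-- Turns the right-hand side of the theorem into the factorisation `u = v ∘ fiberIntegral Ω`. -/
theorem restriction_tensor_apply {Ω : Opens (E × ℝ)} (v : 𝓓'(projFst Ω, ℝ)) (φ : 𝓓(Ω, ℝ)) :
    restriction (le_prodOpens_projFst Ω)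
      (tensor v (regular (⊤ : Opens ℝ) (indicator univ (fun _ => (1 : ℝ))))) φ =
      v (fiberIntegral Ω φ) := rfl

theorem fiberIntegral_lineDeriv {Ω : Opens (E × ℝ)} (φ : 𝓓(Ω, ℝ)) :
    fiberIntegral Ω (∂_{((0, 1) : E × ℝ)} φ) = 0 := by
  ext x
  rw [fiberIntegral_apply]
  refine integral_eq_zero_of_hasDerivAt_of_integrable (f := fun y => φ (x, y)) (fun y => ?_)
    (integrable_slice _ x) (integrable_slice φ x)
  rw [← deriv_slice]
  exact ((contDiff_slice φ x).differentiable (by simp) y).hasDerivAt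

end FiberIntegral

/-! ### Primitives along the fibres -/

/-- Convolution with the Heaviside function is integration from `-∞`. -/
theorem convolution_indicator_Ici (g : ℝ → ℝ) (y : ℝ) :
    (indicator (Ici (0 : ℝ)) (fun _ => (1 : ℝ)) ⋆[ContinuousLinearMap.mul ℝ ℝ, volume] g) y =
      ∫ t in Iic y, g t := by
  rw [convolution_eq_swap, ← integral_indicator measurableSet_Iic]
  congr 1
  ext t
  by_cases h : t ≤ y <;> simp [indicator, h]

theorem locallyIntegrable_indicator_Ici :
    LocallyIntegrable (indicator (Ici (0 : ℝ)) (fun _ => (1 : ℝ))) volume :=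
  (locallyIntegrable_const 1).indicator measurableSet_Ici

/-- The primitive is a convolution of the Heaviside function with a compactly supported function
depending smoothly on the parameter `x`, so joint smoothness comes from the theorem on convolutions
with parameters. -/
theorem contDiff_integral_Iic {U : Opens (E × ℝ)} (φ : 𝓓(U, ℝ)) :
    ContDiff ℝ ∞ fun z : E × ℝ => ∫ t in Iic z.2, φ (z.1, t) := by
  have h := contDiffOn_convolution_right_with_param (𝕜 := ℝ) (μ := volume) (n := ⊤)
    (ContinuousLinearMap.mul ℝ ℝ) (g := fun (x : E) (y : ℝ) => φ (x, y)) (s := univ)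
    (k := Prod.snd '' tsupport φ) isOpen_univ (φ.hasCompactSupport.isCompact.image continuous_snd)
    (fun x y _ hy => by
      by_contra h
      exact hy ⟨(x, y), subset_tsupport _ h, rfl⟩)
    locallyIntegrable_indicator_Ici φ.contDiff.contDiffOn
  rw [univ_prod_univ, contDiffOn_univ] at h
  simpa only [convolution_indicator_Ici] using h

theorem hasDerivAt_integral_Iic {g : ℝ → ℝ} (hg : ContDiff ℝ 1 g) (hs : HasCompactSupport g)
    (y : ℝ) : HasDerivAt (fun y => ∫ t in Iic y, g t) (g y) y := by
  have h := hs.hasDerivAt_convolution_right (ContinuousLinearMap.mul ℝ ℝ)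
    locallyIntegrable_indicator_Ici hg y
  rw [convolution_indicator_Ici, hs.integral_Iic_deriv_eq hg] at h
  simpa only [funext (convolution_indicator_Ici g)] using h

/-- On a `y`-simple set, a test function whose integrals along all fibres vanish is a
`y`-derivative of a test function. -/
theorem IsYSimple.exists_lineDeriv_eq {Ω : Opens (E × ℝ)} (hΩ : IsYSimple (Ω : Set (E × ℝ)))
    (φ : 𝓓(Ω, ℝ)) (hφ : ∀ x, ∫ y, φ (x, y) = 0) :
    ∃ Φ : 𝓓(Ω, ℝ), ∂_{((0, 1) : E × ℝ)} Φ = φ := by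
  have hH : IsCompact (verticalHull (tsupport φ)) := isCompact_verticalHull φ.hasCompactSupport
  have hs : tsupport (fun z : E × ℝ => ∫ t in Iic z.2, φ (z.1, t)) ⊆
      verticalHull (tsupport φ) := by
    refine closure_minimal (fun ⟨x, y⟩ hz => ?_) hH.isClosed
    have hz' : ∫ t in Iic y, φ (x, t) ≠ 0 := hz
    -- A nonzero primitive at `y` forces `φ(x, ·)` to be nonzero somewhere below `y`, and also
    -- somewhere above: otherwise the integral up to `y` would be the full one, which is zero.
    have h1 : ∃ a ≤ y, φ (x, a) ≠ 0 := by
      by_contra! h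
      exact hz' (setIntegral_eq_zero_of_forall_eq_zero fun t ht => h t ht)
    have h2 : ∃ b, y ≤ b ∧ φ (x, b) ≠ 0 := by
      by_contra! h
      refine hz' ?_
      rw [setIntegral_eq_integral_of_forall_compl_eq_zero, hφ]
      exact fun t ht => h t (not_le.1 ht).le
    obtain ⟨a, hay, ha⟩ := h1
    obtain ⟨b, hyb, hb⟩ := h2
    exact ⟨a, b, subset_tsupport _ ha, subset_tsupport _ hb, hay, hyb⟩
  let Φ : 𝓓(Ω, ℝ) := ⟨_, contDiff_integral_Iic φ, hH.of_isClosed_subset (isClosed_tsupport _) hs,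
    hs.trans (hΩ.verticalHull_subset φ.tsupport_subset)⟩
  refine ⟨Φ, TestFunction.ext fun ⟨x, y⟩ => ?_⟩
  rw [← deriv_slice]
  exact (hasDerivAt_integral_Iic ((contDiff_slice φ x).of_le (mod_cast le_top))
    (hasCompactSupport_slice φ x) y).deriv

/-! ### Sections of the fibre integral and factorisation -/

variable [FiniteDimensional ℝ E]

/-- There are test functions on `Ω` with integral `1` along all fibres over a given compact subset
of the projection. -/
theorem exists_fiberIntegral_eq_one (Ω : Opens (E × ℝ)) {K : Set E} (hK : IsCompact K)
    (hKΩ : K ⊆ projFst Ω) : ∃ θ : 𝓓(Ω, ℝ), ∀ x ∈ K, fiberIntegral Ω θ x = 1 := by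
  obtain ⟨L, hL, hLΩ, hKL⟩ := exists_isCompact_image_superset isOpenMap_fst Ω.isOpen hK hKΩ
  obtain ⟨η, hη, hη1⟩ := exists_testFunction_eq_one Ω hL hLΩ
  set J := fiberIntegral Ω η with hJ
  have hJ0 : ∀ x, 0 ≤ J x := fun x => by
    rw [hJ, fiberIntegral_apply]
    exact integral_nonneg fun y => (hη _).1
  let P : Opens E := ⟨{x | 0 < J x}, isOpen_lt continuous_const J.continuous⟩
  have hKP : K ⊆ P := by
    intro x hx
    obtain ⟨⟨x', y⟩, hz, rfl⟩ := hKL hx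
    change 0 < J x'
    rw [hJ, fiberIntegral_apply]
    refine (contDiff_slice η x').continuous.integral_pos_of_hasCompactSupport_nonneg_nonzero
      (hasCompactSupport_slice η x') (fun y => (hη _).1) (x := y) ?_
    rw [hη1 _ hz]
    exact one_ne_zero
  obtain ⟨κ, hκ, hκ1⟩ := exists_testFunction_eq_one P hK hKP
  -- This denominator equals `J` on `K`, where `κ = 1`, but stays positive everywhere: `κ ≤ 1` where
  -- `J > 0`, and `κ = 0` elsewhere. So `η` can be normalised smoothly without dividing by zero.
  have hD : ∀ x, 0 < J x + 1 - κ x := fun x => by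
    by_cases h : x ∈ P
    · have h1 : 0 < J x := h
      linarith [(hκ x).2]
    · have h1 : κ x = 0 := by
        by_contra h'
        exact h (κ.tsupport_subset (subset_tsupport _ h'))
      linarith [hJ0 x]
  have hsupp : tsupport (fun z : E × ℝ => η z / (J z.1 + 1 - κ z.1)) ⊆ tsupport η :=
    closure_mono fun z hz h => hz (by simp [h])
  refine ⟨⟨fun z => η z / (J z.1 + 1 - κ z.1), ?_,
    η.hasCompactSupport.isCompact.of_isClosed_subset (isClosed_tsupport _) hsupp,
    hsupp.trans η.tsupport_subset⟩, fun x hx => ?_⟩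
  · exact η.contDiff.div (((J.contDiff.comp contDiff_fst).add contDiff_const).sub
      (κ.contDiff.comp contDiff_fst)) fun z => (hD z.1).ne'
  · rw [fiberIntegral_apply]
    change ∫ y, η (x, y) / (J x + 1 - κ x) = 1
    have h1 : 0 < J x := hKP hx
    rw [integral_div, ← fiberIntegral_apply, ← hJ, hκ1 x hx, add_sub_cancel_right,
      div_self h1.ne']

/-- The factor `f x` is constant along fibres and comes out of the integral; off `K` both sides
vanish, whatever `θ` is there. -/
theorem fiberIntegral_mulFst {Ω : Opens (E × ℝ)} {K : Compacts E}
    (hK : (K : Set E) ⊆ projFst Ω) {θ : 𝓓(Ω, ℝ)} (hθ : ∀ x ∈ K, fiberIntegral Ω θ x = 1)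
    (f : 𝓓_{K}(E, ℝ)) :
    fiberIntegral Ω (mulFst θ K f) = TestFunction.ofSupportedIn hK f := by
  ext x
  change fiberIntegral Ω (mulFst θ K f) x = f x
  rw [fiberIntegral_apply]
  simp only [mulFst_apply]
  rw [integral_const_mul, ← fiberIntegral_apply]
  by_cases h : x ∈ K
  · rw [hθ x h, mul_one]
  · rw [f.zero_on_compl h, Pi.zero_apply, zero_mul]

theorem fiberIntegral_surjective (Ω : Opens (E × ℝ)) : Function.Surjective (fiberIntegral Ω) := by
  intro ψ
  let K : Compacts E := ⟨tsupport ψ, ψ.hasCompactSupport⟩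
  obtain ⟨θ, hθ⟩ := exists_fiberIntegral_eq_one Ω K.isCompact ψ.tsupport_subset
  exact ⟨_, fiberIntegral_mulFst ψ.tsupport_subset hθ
    (.of_support_subset ψ.contDiff (subset_tsupport ψ))⟩

/-- A distribution that vanishes on the kernel of `fiberIntegral` factors through it. -/
theorem exists_eq_comp_fiberIntegral {Ω : Opens (E × ℝ)} (u : 𝓓'(Ω, ℝ))
    (hu : ∀ φ, fiberIntegral Ω φ = 0 → u φ = 0) :
    ∃ v : 𝓓'(projFst Ω, ℝ), ∀ φ, u φ = v (fiberIntegral Ω φ) := by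
  have heq : ∀ φ φ', fiberIntegral Ω φ = fiberIntegral Ω φ' → u φ = u φ' := fun φ φ' h => by
    rw [← sub_eq_zero, ← map_sub]
    exact hu _ (by rw [map_sub, h, sub_self])
  choose S hS using fiberIntegral_surjective Ω
  choose θ hθ using fun (K : Compacts E) (hK : (K : Set E) ⊆ projFst Ω) =>
    exists_fiberIntegral_eq_one Ω K.isCompact hK
  -- The chosen preimages `S ψ` need be neither linear nor continuous in `ψ`. By `heq`, `u (S ψ)`
  -- does not depend on the choice, and on functions supported in `K` it agrees with the continuous
  -- linear map given by the section `mulFst`.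
  let v : 𝓓(projFst Ω, ℝ) →L[ℝ] ℝ := TestFunction.limitCLM ℝ (fun ψ => u (S ψ))
    (fun K hK => (u : 𝓓(Ω, ℝ) →L[ℝ] ℝ).comp (mulFst (θ K hK) K))
    (fun K hK f => heq _ _ ((hS _).trans (fiberIntegral_mulFst hK (hθ K hK) f).symm))
  exact ⟨v, fun φ => heq _ _ (hS _).symm⟩

theorem IsYSimple.lineDeriv_eq_zero_iff {Ω : Opens (E × ℝ)} (hΩ : IsYSimple (Ω : Set (E × ℝ)))
    (u : 𝓓'(Ω, ℝ)) :
    ∂_{((0, 1) : E × ℝ)} u = 0 ↔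
      ∃ v : 𝓓'(projFst Ω, ℝ),
        u = restriction (le_prodOpens_projFst Ω)
          (tensor v (regular (⊤ : Opens ℝ) (indicator univ (fun _ => (1 : ℝ))))) := by
  constructor
  · intro h
    obtain ⟨v, hv⟩ := exists_eq_comp_fiberIntegral u fun φ hφ => by
      obtain ⟨Φ, rfl⟩ := hΩ.exists_lineDeriv_eq φ fun x => by
        rw [← fiberIntegral_apply, hφ]
        rfl
      have h1 : (∂_{((0, 1) : E × ℝ)} u : 𝓓'(Ω, ℝ)) Φ = 0 := by
        rw [h]
        rfl
      rwa [Distribution.lineDerivOp_apply_apply, map_neg, neg_eq_zero] at h1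
    exact ⟨v, DFunLike.ext _ _ hv⟩
  · rintro ⟨v, rfl⟩
    refine DFunLike.ext _ _ fun φ => ?_
    rw [Distribution.lineDerivOp_apply_apply, map_neg, restriction_tensor_apply,
      fiberIntegral_lineDeriv, map_zero, neg_zero]
    rfl

end DistributionTensor

end

theorem mainTheorem10 (n : ℕ) (Ω : Opens (EuclideanSpace ℝ (Fin n) × ℝ))
    (hΩ : DistributionTensor.IsYSimple (Ω : Set (EuclideanSpace ℝ (Fin n) × ℝ)))
    (u : 𝓓'(Ω, ℝ)) :
    ∂_{((0, 1) : EuclideanSpace ℝ (Fin n) × ℝ)} u = 0 ↔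
      ∃ v : 𝓓'(DistributionTensor.projFst Ω, ℝ),
        u = DistributionTensor.restriction (DistributionTensor.le_prodOpens_projFst Ω)
          (DistributionTensor.tensor v
            (DistributionTensor.regular (⊤ : Opens ℝ) (indicator univ (fun _ => (1 : ℝ))))) := by
  exact hΩ.lineDeriv_eq_zero_iff u
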